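/- Let $\mathcal V$ be a complete and cocomplete symmetric monoidal closed category, with tensor $\otimes$ and unit $I$, whose underlying ordinary category $\mathcal V_0$ is locally small and locally presentable. For a $\mathcal V$-category $\mathcal K$, write $\mathcal K_0$ for its underlying ordinary category. All colimits in $\mathcal V$-categories are conical colimits in the enriched sense: a cocone $(S_j\to C)_{j\in\mathcal J}$ in $\mathcal K_0$ over an ordinary small diagram $S:\mathcal J\to\mathcal K_0$ is a colimit in $\mathcal K$ if for every object $A$ the induced cone $\mathcal K(C,A)\to\mathcal K(S_j,A)$ is a limit cone in $\mathcal V_0$. For a regular cardinal $\lambda$, a $\lambda$-filtered colimit is one for which $\mathcal J$ is a $\lambda$-filtered ordinary category. An object $G\in\mathcal K$ is $\lambda$-presentable if $\mathcal K(G,-):\mathcal K\to\mathcal V$ preserves $\lambda$-filtered colimits. The $\mathcal V$-category $\mathcal K$ is *locally $\lambda$-presentable* if it is cocomplete (it has all small colimits and all copowers $X\cdot A$ with $X\in\mathcal V$, $A\in\mathcal K$) and has a small family $(G_i)$ of $\lambda$-presentable objects that is a strong generator: a morphism $f$ of $\mathcal K_0$ is invertible whenever all $\mathcal K(G_i,f)$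 are invertible in $\mathcal V_0$. A $\mathcal V$-category is *$\lambda$-accessible* if it has $\lambda$-filtered colimits and a small family of $\lambda$-presentable objects such that every object is a $\lambda$-filtered colimit of objects of the family (so that it is the free completion under $\lambda$-filtered colimits of a small $\mathcal V$-category); it is *accessible* if it is $\mu$-accessible for some regular cardinal $\mu$. In an ordinary category, a morphism $f:A\to B$ is *$\lambda$-pure* if for every commutative square $vg=fu$ with $g:C\to D$, $u:C\to A$, $v:D\to B$, where $C$ and $D$ are $\lambda$-presentable, there is a morphism $w:D\to A$ with $wg=u$. A full subcategory is *closed under $\lambda$-pure subobjects* if it contains $A$ whenever it contains $B$ and there is a $\lambda$-pure monomorphism $A\to B$. **Theorem.** Let $\lambda$ be a regular cardinal, let $\mathcal K$ be a locally $\lambda$-presentable $\mathcal V$-category, and let $\mathcal A$ be a full sub-$\mathcal V$-category of $\mathcal K$ closed under $\lambda$-filtered colimits. If $\mathcal A_0$ is closed in $\mathcal K_0$ under $\lambda$-pure subobjects, then $\mathcal A$ is accessible as a $\mathcal V$-category. -/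

import Mathlib

open CategoryTheory Limits MonoidalCategory Opposite

universe w u₁ u₂ v₂

namespace VCategory

variable (V : Type u₁) [Category.{w} V] [MonoidalCategory V]
variable {C : Type u₂} [Category.{v₂} C] [EnrichedOrdinaryCategory V C]

/-! Throughout, `C` is a `V`-category together with its underlying ordinary category:
`X ⟶[V] Y` is the hom-object in `V`, and `X ⟶ Y` is identified with `𝟙_ V ⟶ (X ⟶[V] Y)`.
The word "small" refers to the universe `w`. -/

/-- A cocone on an ordinary diagram `F` in a `V`-category is a (conical) colimit if for every
object `A` the induced cone, with vertex the hom-object `c.pt ⟶[V] A` and over the diagram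
`j ↦ (F.obj j ⟶[V] A)`, is a limit cone in `V`. -/
def IsConicalColimit {J : Type w} [SmallCategory J] {F : J ⥤ C} (c : Cocone F) : Prop :=
  ∀ A : C, Nonempty (IsLimit (((eHomFunctor V C).flip.obj A).mapCone c.op))

/-- The morphism `η : X ⟶ (A ⟶[V] T)` exhibits `T` as the copower (tensor) `X · A`: for every `B`
the morphism `(T ⟶[V] B) ⟶ [X, (A ⟶[V] B)]` into the internal hom of `V` which is induced by `η`
and composition is invertible. -/
def IsCopower [MonoidalClosed V] {X : V} {A T : C} (η : X ⟶ (A ⟶[V] T)) : Prop :=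
  ∀ B : C, IsIso (MonoidalClosed.curry (η ▷ (T ⟶[V] B) ≫ eComp V A T B))

variable (C) in
/-- A `V`-category is cocomplete if it has all small conical colimits and all copowers
(equivalently, all small weighted colimits). -/
structure IsCocomplete [MonoidalClosed V] : Prop where
  conicalColimits (J : Type w) [SmallCategory J] (F : J ⥤ C) :
    ∃ c : Cocone F, IsConicalColimit V c
  copowers (X : V) (A : C) : ∃ (T : C) (η : X ⟶ (A ⟶[V] T)), IsCopower V η

/-- An object `G` of a `V`-category is `κ`-presentable (in the enriched sense) if the `V`-functor
`(G ⟶[V] -)` to `V` sends `κ`-filtered colimits to colimits in `V`. (A colimit in the ordinary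
category `V` is automatically a colimit in the `V`-category `V`.) -/
def IsPresentableObject (κ : Cardinal.{w}) [Fact κ.IsRegular] (G : C) : Prop :=
  ∀ (J : Type w) [SmallCategory J] [IsCardinalFiltered J κ] (F : J ⥤ C) (c : Cocone F),
    IsConicalColimit V c → Nonempty (IsColimit ((eCoyoneda V G).mapCocone c))

/-- A family of objects of a `V`-category is a strong generator (in the enriched sense) if the
`V`-functors `(G i ⟶[V] -)` to `V` are jointly conservative. -/
def IsStrongGenerator {ι : Type w} (G : ι → C) : Prop :=
  ∀ ⦃X Y : C⦄ (f : X ⟶ Y), (∀ i, IsIso (eHomWhiskerLeft V (G i) f)) → IsIso f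

variable (C) in
/-- A `V`-category is locally `κ`-presentable if it is cocomplete and has a small strong generator
consisting of `κ`-presentable objects. -/
structure IsLocallyCardinalPresentable [MonoidalClosed V]
    (κ : Cardinal.{w}) [Fact κ.IsRegular] : Prop where
  cocomplete : IsCocomplete V C
  exists_strongGenerator : ∃ (ι : Type w) (G : ι → C),
    (∀ i, IsPresentableObject V κ (G i)) ∧ IsStrongGenerator V G

variable (C) in
/-- A `V`-category is `κ`-accessible if it has `κ`-filtered colimits and a small family of
`κ`-presentable objects such that every object is a `κ`-filtered colimit of objects of the family.
All colimits are conical colimits in the enriched sense. The family spans a small full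
sub-`V`-category, whose free completion under `κ`-filtered colimits is the given `V`-category. -/
structure IsCardinalAccessible (κ : Cardinal.{w}) [Fact κ.IsRegular] : Prop where
  filteredColimits (J : Type w) [SmallCategory J] [IsCardinalFiltered J κ] (F : J ⥤ C) :
    ∃ c : Cocone F, IsConicalColimit V c
  exists_generator : ∃ (ι : Type w) (G : ι → C), (∀ i, IsPresentableObject V κ (G i)) ∧
    ∀ X : C, ∃ (J : Type w) (_ : SmallCategory J) (_ : IsCardinalFiltered J κ) (F : J ⥤ C)
      (s : F ⟶ (Functor.const J).obj X),
      (∀ j, ∃ i, Nonempty (F.obj j ≅ G i)) ∧ IsConicalColimit V (Cocone.mk X s)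

variable (C) in
/-- A `V`-category is accessible if it is `κ`-accessible for some regular cardinal `κ`. -/
def IsAccessible : Prop :=
  ∃ (κ : Cardinal.{w}) (_ : Fact κ.IsRegular), IsCardinalAccessible V C κ

/-- The full subcategory on the objects satisfying `P` is closed under `κ`-filtered colimits.
(The case of a one-object diagram shows that `P` is then closed under isomorphisms.) -/
def IsClosedUnderFilteredColimits (κ : Cardinal.{w}) [Fact κ.IsRegular]
    (P : ObjectProperty C) : Prop :=
  ∀ (J : Type w) [SmallCategory J] [IsCardinalFiltered J κ] (F : J ⥤ C) (c : Cocone F),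
    IsConicalColimit V c → (∀ j, P (F.obj j)) → P c.pt

end VCategory

namespace OrdinaryPurity

variable {C : Type u₂} [Category.{v₂} C]

/-- A morphism `f : A ⟶ B` of an ordinary category is `κ`-pure if in every commutative square
`g ≫ v = u ≫ f` with `g : X ⟶ Y` a morphism between `κ`-presentable objects, `u : X ⟶ A` factors
through `g`. -/
def IsPure (κ : Cardinal.{w}) [Fact κ.IsRegular] {A B : C} (f : A ⟶ B) : Prop :=
  ∀ ⦃X Y : C⦄, IsCardinalPresentable X κ → IsCardinalPresentable Y κ →
    ∀ (g : X ⟶ Y) (u : X ⟶ A) (v : Y ⟶ B), g ≫ v = u ≫ f → ∃ t : Y ⟶ A, g ≫ t = u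

/-- The full subcategory on the objects satisfying `P` is closed under `κ`-pure subobjects. (In a
locally `κ`-presentable category every `κ`-pure morphism is a monomorphism.) -/
def IsClosedUnderPureSubobjects (κ : Cardinal.{w}) [Fact κ.IsRegular]
    (P : ObjectProperty C) : Prop :=
  ∀ ⦃A B : C⦄ (f : A ⟶ B), Mono f → IsPure κ f → P B → P A

end OrdinaryPurity

/-! For large ν, every object of `K` is a ν-filtered colimit of ν-presentable κ-pure subobjects. If
the object lies in `A`, so do these subobjects; hence the ν-presentable objects lying in `A`
generate it. Two facts carry this.

The ordinary one is `exists_pure_presentation`. Write B as a μ-directed colimit of μ-presentable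
objects, and choose θ with θ ^ μ = θ bounding, independently of B, the number of lifting problems at
one index. The μ-directed sets of at most θ indices that contain a stage solving each solvable
problem form a θ⁺-directed cover of the index poset, and the colimit over such a set is
θ⁺-presentable and μ-pure in B.

The enriched one is `IsLocallyCardinalPresentable.exists_le`. Copowers of the strong generator by a
jointly conservative family in V are jointly conservative in the underlying category. So for all
large ν that category is locally ν-presentable, and its ν-presentable objects are obtained from
these copowers by ν-small colimits, which preserve enriched ν-presentability.

As `K` has all conical colimits, ordinary colimits in it are conical, so the ordinary presentation
is an enriched one. -/

/-! ### Closing small sets under operations. -/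

namespace Cardinal

/-- A subset of cardinality at most `θ` is contained in a subset of cardinality at most `θ`
which is closed under `θ` many operations of arity `T`, if `θ ^ #T = θ`. -/
theorem exists_superset_closed_under_operations {I Θ T : Type w} {θ : Cardinal.{w}}
    (hθ : ℵ₀ ≤ θ) (hT : θ ^ #T = θ) (hΘ : #Θ ≤ θ) (op : Θ → (T → I) → I)
    (A : Set I) (hA : #A ≤ θ) :
    ∃ J : Set I, A ⊆ J ∧ #J ≤ θ ∧ ∀ (t : Θ) (s : T → I), (∀ x, s x ∈ J) → op t s ∈ J := by
  -- The closure is the set of values of well-founded terms with leaves in `A` and `T`-ary nodes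
  -- labelled by `Θ`; θ ^ #T = θ bounds the number of terms.
  let β : A ⊕ Θ → Type w := Sum.elim (fun _ ↦ PEmpty) (fun _ ↦ T)
  let ev : WType β → I := WType.elim I (fun x ↦ match x with
    | ⟨Sum.inl a, _⟩ => a.1
    | ⟨Sum.inr t, s⟩ => op t s)
  refine ⟨Set.range ev, fun a ha ↦ ⟨WType.mk (Sum.inl ⟨a, ha⟩) PEmpty.elim, rfl⟩,
    mk_range_le.trans (WType.cardinalMk_le_of_le ?_), fun t s hs ↦ ?_⟩
  · have h1 : ∀ x, θ ^ #(β x) ≤ θ := by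
      rintro (a | t)
      · simpa [β] using one_le_aleph0.trans hθ
      · exact hT.le
    refine (sum_le_sum _ (fun _ ↦ θ) h1).trans ?_
    rw [sum_const, lift_id, lift_id]
    refine mul_le_of_le hθ ?_ le_rfl
    rw [mk_sum, lift_id, lift_id]
    exact add_le_of_le hθ hA hΘ
  · choose f hf using hs
    refine ⟨WType.mk (Sum.inr t) f, ?_⟩
    have : s = fun x ↦ ev (f x) := funext fun x ↦ (hf x).symm
    rw [this]
    rfl

end Cardinal

namespace CategoryTheory.IsCardinalFiltered

variable {μ : Cardinal.{w}} [Fact μ.IsRegular]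

open Cardinal in
/-- A subset of cardinality at most `θ` of a `μ`-directed poset is contained in a `μ`-directed
subset of cardinality at most `θ` which is closed under `θ` many unary operations,
if `θ ^ μ = θ`. -/
theorem exists_superset_directed_closed {I Θ : Type w} [PartialOrder I] [IsCardinalFiltered I μ]
    {θ : Cardinal.{w}} (hθ : ℵ₀ ≤ θ) (hμ : θ ^ μ = θ) (hΘ : #Θ ≤ θ) (op : Θ → I → I)
    (A : Set I) (hA : #A ≤ θ) :
    ∃ J : Set I, A ⊆ J ∧ #J ≤ θ ∧ IsCardinalFiltered J μ ∧ ∀ t, ∀ j ∈ J, op t j ∈ J := by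
  classical
  let T : Type w := μ.ord.ToType
  have hT : #T = μ := by simp [T]
  have hμ0 : ℵ₀ ≤ μ := IsRegular.aleph0_le Fact.out
  have : Nonempty T := by
    rw [← mk_ne_zero_iff, hT]
    exact (aleph0_pos.trans_le hμ0).ne'
  have : Nonempty I := IsCardinalFiltered.nonempty I μ
  let i₀ : I := Classical.arbitrary I
  let t₀ : T := Classical.arbitrary T
  let ub (s : T → I) : I := if h : HasCardinalLT (Set.range s) μ then
    IsCardinalFiltered.max (fun x : Set.range s ↦ x.1) h else i₀
  -- A nonempty family of fewer than μ elements can be enumerated by `T` with repetitions, so one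
  -- `T`-ary operation gives all its upper bounds; `i₀` bounds the empty family. A unary operation
  -- is read off at the coordinate `t₀`.
  obtain ⟨J, hAJ, hJ, hcl⟩ := exists_superset_closed_under_operations (I := I)
    (Θ := Option Θ) (T := T) hθ (by rw [hT, hμ])
    (by rw [mk_option]; exact add_le_of_le hθ hΘ (one_le_aleph0.trans hθ))
    (fun t s ↦ t.elim (ub s) (fun t ↦ op t (s t₀))) (insert i₀ A)
    (mk_insert_le.trans (add_le_of_le hθ hA (one_le_aleph0.trans hθ)))
  refine ⟨J, (Set.subset_insert _ _).trans hAJ, hJ, ?_,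
    fun t j hj ↦ hcl (some t) (fun _ ↦ j) (fun _ ↦ hj)⟩
  refine isCardinalFiltered_preorder _ _ (fun K f hK ↦ ?_)
  by_cases hK0 : Nonempty K
  · obtain ⟨g, hg⟩ : ∃ g : T → K, Function.Surjective g := by
      obtain ⟨e⟩ : #K ≤ #T := by rw [hT]; exact hK.le
      exact ⟨Function.invFun e, Function.invFun_surjective e.injective⟩
    have h : HasCardinalLT (Set.range (fun x ↦ (f (g x)).1)) μ := by
      rw [hasCardinalLT_iff_cardinal_mk_lt]
      refine lt_of_le_of_lt (mk_le_mk_of_subset ?_)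
        ((mk_range_le (f := fun k ↦ (f k).1)).trans_lt hK)
      rintro _ ⟨x, rfl⟩
      exact ⟨_, rfl⟩
    refine ⟨⟨ub (fun x ↦ (f (g x)).1), hcl none _ (fun x ↦ (f (g x)).2)⟩, fun k ↦ ?_⟩
    obtain ⟨x, rfl⟩ := hg k
    rw [← Subtype.coe_le_coe]
    dsimp only [ub]
    rw [dif_pos h]
    exact leOfHom (IsCardinalFiltered.toMax
      (fun x : Set.range (fun x ↦ (f (g x)).1) ↦ x.1) h ⟨_, x, rfl⟩)
  · exact ⟨⟨i₀, hAJ (Set.mem_insert _ _)⟩, fun k ↦ (hK0 ⟨k⟩).elim⟩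

end CategoryTheory.IsCardinalFiltered

/-! ### Colimits over subsets of the index poset. -/

namespace CategoryTheory

/-- The colimit of the restriction to a subset `S` of a diagram indexed by a preorder. -/
noncomputable abbrev colimitRestrict {K : Type u₂} [Category.{v₂} K] [HasColimitsOfSize.{w, w} K]
    {I : Type w} [Preorder I] (F : I ⥤ K) (S : Set I) : K :=
  colimit ((Subtype.mono_coe (· ∈ S)).functor ⋙ F)

namespace colimitRestrict

variable {K : Type u₂} [Category.{v₂} K] [HasColimitsOfSize.{w, w} K]
  {I : Type w} [Preorder I] (F : I ⥤ K)

/-- The inclusion of a term of the diagram. -/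
noncomputable def inj {S : Set I} (i : I) (hi : i ∈ S) : F.obj i ⟶ colimitRestrict F S :=
  colimit.ι ((Subtype.mono_coe (· ∈ S)).functor ⋙ F) ⟨i, hi⟩

@[simp]
lemma map_inj {S : Set I} {i j : I} (f : i ⟶ j) (hi : i ∈ S) (hj : j ∈ S) :
    F.map f ≫ inj F j hj = inj F i hi :=
  colimit.w ((Subtype.mono_coe (· ∈ S)).functor ⋙ F)
    (homOfLE (leOfHom f) : (⟨i, hi⟩ : S) ⟶ ⟨j, hj⟩)

@[simp]
lemma map_inj_assoc {S : Set I} {i j : I} (f : i ⟶ j) (hi : i ∈ S) (hj : j ∈ S) {X : K}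
    (g : colimitRestrict F S ⟶ X) : F.map f ≫ inj F j hj ≫ g = inj F i hi ≫ g := by
  rw [← Category.assoc, map_inj]

/-- The morphism from the colimit over `S` to the point of a cocone over the whole diagram. -/
noncomputable def toPt (c : Cocone F) (S : Set I) : colimitRestrict F S ⟶ c.pt :=
  colimit.desc ((Subtype.mono_coe (· ∈ S)).functor ⋙ F) (c.whisker _)

@[simp]
lemma inj_toPt (c : Cocone F) {S : Set I} (i : I) (hi : i ∈ S) :
    inj F i hi ≫ toPt F c S = c.ι.app i :=
  colimit.ι_desc _ _

lemma inj_toPt_assoc (c : Cocone F) {S : Set I} (i : I) (hi : i ∈ S) {X : K} (g : c.pt ⟶ X) :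
    inj F i hi ≫ toPt F c S ≫ g = c.ι.app i ≫ g := by
  rw [← Category.assoc, inj_toPt]

variable {F} in
@[ext]
lemma hom_ext {S : Set I} {X : K} {f g : colimitRestrict F S ⟶ X}
    (h : ∀ i (hi : i ∈ S), inj F i hi ≫ f = inj F i hi ≫ g) : f = g :=
  colimit.hom_ext fun i ↦ h i.1 i.2

/-- The functoriality of `colimitRestrict` with respect to the inclusion of subsets. -/
noncomputable def map {S T : Set I} (h : S ⊆ T) : colimitRestrict F S ⟶ colimitRestrict F T :=
  colimit.desc ((Subtype.mono_coe (· ∈ S)).functor ⋙ F)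
    { pt := _
      ι := { app i := inj F i.1 (h i.2)
             naturality i j _ :=
              (map_inj F _ (h i.2) (h j.2)).trans (Category.comp_id _).symm } }

@[simp]
lemma inj_map {S T : Set I} (h : S ⊆ T) (i : I) (hi : i ∈ S) :
    inj F i hi ≫ map F h = inj F i (h hi) :=
  colimit.ι_desc _ _

@[simp]
lemma inj_map_assoc {S T : Set I} (h : S ⊆ T) (i : I) (hi : i ∈ S) {X : K}
    (g : colimitRestrict F T ⟶ X) : inj F i hi ≫ map F h ≫ g = inj F i (h hi) ≫ g := by
  rw [← Category.assoc, inj_map]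

@[simp]
lemma map_toPt (c : Cocone F) {S T : Set I} (h : S ⊆ T) :
    map F h ≫ toPt F c T = toPt F c S := by
  ext; simp

/-- The diagram of the colimits over the subsets satisfying `P`. -/
noncomputable def functor (P : Set I → Prop) : Subtype P ⥤ K where
  obj S := colimitRestrict F S.1
  map f := map F (leOfHom f)
  map_id _ := by ext; simp
  map_comp _ _ := by ext; simp

/-- The cocone on `functor F P` given by a cocone on `F`. -/
noncomputable def cocone (c : Cocone F) (P : Set I → Prop) : Cocone (functor F P) where
  pt := c.pt
  ι :=
    { app S := toPt F c S.1
      naturality S T f := by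
        simp [functor] }

/-- A colimit over a preorder is the colimit of the colimits over subsets in a directed
family covering the preorder. -/
noncomputable def isColimitCocone {c : Cocone F} (hc : IsColimit c) (P : Set I → Prop)
    (hP : ∀ i, ∃ S, P S ∧ i ∈ S) (hdir : ∀ S T : Subtype P, ∃ U : Subtype P, S ≤ U ∧ T ≤ U) :
    IsColimit (cocone F c P) := by
  choose S hS hiS using hP
  -- The leg at `i` does not depend on the chosen set containing `i`: compare two choices in a
  -- common upper bound.
  have key (s : Cocone (functor F P)) (i : I) (U : Subtype P) (hi : i ∈ U.1) :
      inj F i (hiS i) ≫ s.ι.app ⟨S i, hS i⟩ = inj F i hi ≫ s.ι.app U := by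
    obtain ⟨W, h1, h2⟩ := hdir ⟨S i, hS i⟩ U
    rw [← s.w (homOfLE h1), ← s.w (homOfLE h2)]
    simp [functor]
  let c' (s : Cocone (functor F P)) : Cocone F :=
    { pt := s.pt
      ι :=
        { app i := inj F i (hiS i) ≫ s.ι.app ⟨S i, hS i⟩
          naturality i j f := by
            obtain ⟨W, h1, h2⟩ := hdir ⟨S i, hS i⟩ ⟨S j, hS j⟩
            have hi : i ∈ W.1 := h1 (hiS i)
            have hj : j ∈ W.1 := h2 (hiS j)
            rw [key s i W hi, key s j W hj]
            exact (map_inj_assoc F f hi hj _).trans (Category.comp_id _).symm } }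
  exact
    { desc s := hc.desc (c' s)
      fac s U := by
        apply hom_ext
        intro i hi
        refine (inj_toPt_assoc F c i hi _).trans ?_
        rw [hc.fac]
        exact key s i U hi
      uniq s m hm := hc.hom_ext fun i ↦ by
        rw [hc.fac]
        dsimp [c']
        rw [← hm]
        exact (inj_toPt_assoc F c i (hiS i) _).symm }

end colimitRestrict

end CategoryTheory

/-! ### Pure morphisms. -/

namespace OrdinaryPurity

variable {K : Type u₂} [Category.{w} K] {μ : Cardinal.{w}} [Fact μ.IsRegular]

lemma IsPure.of_le {κ : Cardinal.{w}} [Fact κ.IsRegular] (h : κ ≤ μ) {A B : K} {f : A ⟶ B}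
    (hf : IsPure μ f) : IsPure κ f :=
  fun X Y _ _ ↦ hf (isCardinalPresentable_of_le X h) (isCardinalPresentable_of_le Y h)

/-- If u and v become equal after f, lift against the codiagonal X ⨿ X ⟶ X: the lift equals both u
and v. -/
lemma IsPure.mono [IsCardinalLocallyPresentable K μ] {A B : K} {f : A ⟶ B}
    (hf : IsPure μ f) : Mono f := by
  rw [(isCardinalFilteredGenerator_isCardinalPresentable K μ).isStrongGenerator.isSeparating.mono_iff]
  intro X hX u v huv
  have hX2 : IsCardinalPresentable (X ⨿ X) μ := by
    have := isClosedUnderColimitsOfShape_isCardinalPresentable K (κ := μ)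
      (J := Discrete WalkingPair)
      (hasCardinalLT_of_finite _ _ (Cardinal.IsRegular.aleph0_le Fact.out))
    exact ObjectProperty.prop_colimit (P := isCardinalPresentable K μ) (F := pair X X)
      (by rintro (_ | _) <;> exact hX)
  obtain ⟨t, ht⟩ := hf hX2 hX (coprod.desc (𝟙 X) (𝟙 X)) (coprod.desc u v) (u ≫ f)
    (by ext <;> simp [huv])
  have h1 := coprod.inl ≫= ht
  have h2 := coprod.inr ≫= ht
  simp only [coprod.inl_desc_assoc, coprod.inr_desc_assoc, Category.id_comp, coprod.inl_desc,
    coprod.inr_desc] at h1 h2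
  rw [← h1, ← h2]

/-- As X is μ-presentable, u factors through some stage in `S`, and `hS` solves the lifting problem
at a later stage still in `S`. -/
lemma isPure_colimitRestrict_toPt [HasColimitsOfSize.{w, w} K] {ι : Type w} (G : ι → K)
    (hG : ∀ X, IsCardinalPresentable X μ → ∃ x, Nonempty (X ≅ G x))
    {I : Type w} [Preorder I] {F : I ⥤ K} (c : Cocone F) (S : Set I) [IsCardinalFiltered S μ]
    (hS : ∀ j ∈ S, ∀ (x y : ι) (g : G x ⟶ G y) (u : G x ⟶ F.obj j) (v : G y ⟶ c.pt),
      g ≫ v = u ≫ c.ι.app j →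
        ∃ k ∈ S, ∃ (f : j ⟶ k) (t : G y ⟶ F.obj k), g ≫ t = u ≫ F.map f) :
    IsPure μ (colimitRestrict.toPt F c S) := by
  intro X Y hX hY g u v h
  obtain ⟨x, ⟨ex⟩⟩ := hG X hX
  obtain ⟨y, ⟨ey⟩⟩ := hG Y hY
  obtain ⟨j, hj, u', hu'⟩ : ∃ (j : I) (hj : j ∈ S) (u' : X ⟶ F.obj j),
      u' ≫ colimitRestrict.inj F j hj = u := by
    obtain ⟨⟨j, hj⟩, u', hu'⟩ := IsCardinalPresentable.exists_hom_of_isColimit μ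
      (colimit.isColimit ((Subtype.mono_coe (· ∈ S)).functor ⋙ F)) u
    exact ⟨j, hj, u', hu'⟩
  obtain ⟨k, hk, f, t, ht⟩ := hS j hj x y (ex.inv ≫ g ≫ ey.hom) (ex.inv ≫ u') (ey.inv ≫ v) (by
    simp only [Category.assoc, Iso.hom_inv_id_assoc]
    rw [h, ← hu', Category.assoc, colimitRestrict.inj_toPt])
  refine ⟨ey.hom ≫ t ≫ colimitRestrict.inj F k hk, ?_⟩
  rw [← cancel_epi ex.inv]
  simp only [Category.assoc] at ht
  have := ht =≫ colimitRestrict.inj F k hk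
  simp only [Category.assoc] at this
  rw [this, ← hu', colimitRestrict.map_inj F f hj hk]

end OrdinaryPurity

-- For m = max μ α, the witness 2 ^ m works because m * μ = m.
open Cardinal in
lemma Cardinal.exists_power_eq_self {μ : Cardinal.{w}} (hμ : ℵ₀ ≤ μ) (α : Cardinal.{w}) :
    ∃ θ, μ ≤ θ ∧ α ≤ θ ∧ θ ^ μ = θ := by
  refine ⟨2 ^ max μ α, (le_max_left _ _).trans (cantor _).le,
    (le_max_right _ _).trans (cantor _).le, ?_⟩
  rw [← power_mul, mul_eq_left (hμ.trans (le_max_left _ _)) (le_max_left _ _)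
    (aleph0_pos.trans_le hμ).ne']

/-! ### Presentation by small pure subobjects. -/

namespace CategoryTheory.IsCardinalLocallyPresentable

open Cardinal OrdinaryPurity

variable (K : Type u₂) [Category.{w} K] (μ : Cardinal.{w}) [Fact μ.IsRegular]
  [IsCardinalLocallyPresentable K μ]

lemma exists_small_family :
    ∃ (ι : Type w) (G : ι → K), (∀ i, IsCardinalPresentable (G i) μ) ∧
      ∀ X, IsCardinalPresentable X μ → ∃ x, Nonempty (X ≅ G x) := by
  obtain ⟨Q, _, h1, h2⟩ := ObjectProperty.EssentiallySmall.exists_small_le.{w}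
    (isCardinalPresentable K μ)
  refine ⟨Shrink.{w} (Subtype Q), fun x ↦ ((equivShrink _).symm x).1,
    fun x ↦ h1 _ ((equivShrink _).symm x).2, fun X hX ↦ ?_⟩
  obtain ⟨Y, hY, ⟨e⟩⟩ := h2 X hX
  exact ⟨equivShrink _ ⟨Y, hY⟩, ⟨e ≪≫ eqToIso (by simp)⟩⟩

/-- In a locally `μ`-presentable category, there is a regular cardinal `ν ≥ μ` such that every
object is a `ν`-filtered colimit of its `ν`-presentable `μ`-pure subobjects. -/
theorem exists_pure_presentation :
    ∃ (ν : Cardinal.{w}) (_ : Fact ν.IsRegular), μ ≤ ν ∧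
      ∀ B : K, ∃ (J : Type w) (_ : SmallCategory J) (_ : IsCardinalFiltered J ν)
        (F : J ⥤ K) (s : F ⟶ (Functor.const J).obj B), Nonempty (IsColimit (Cocone.mk B s)) ∧
        ∀ j, IsCardinalPresentable (F.obj j) ν ∧ IsPure μ (s.app j) := by
  obtain ⟨ι, G, hG', hG⟩ := exists_small_family K μ
  have hμ : ℵ₀ ≤ μ := IsRegular.aleph0_le Fact.out
  -- Codes for lifting problems, with the terms of the diagram replaced by isomorphic members of
  -- `G`; hence `Θ`, and so θ, does not depend on B. The extra `none` codes the operation that stays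
  -- at j.
  let Θ : Type w := Option (Σ x y z : ι, (G x ⟶ G y) × (G x ⟶ G z))
  obtain ⟨θ, hμθ, hΘ, hθ⟩ := exists_power_eq_self hμ #Θ
  have hθ0 : ℵ₀ ≤ θ := hμ.trans hμθ
  have : Fact (Order.succ θ).IsRegular := ⟨isRegular_succ hθ0⟩
  have hle : μ ≤ Order.succ θ := hμθ.trans (Order.le_succ θ)
  refine ⟨Order.succ θ, inferInstance, hle, fun B ↦ ?_⟩
  obtain ⟨J, _, _, ⟨p⟩⟩ :=
    (isCardinalFilteredGenerator_isCardinalPresentable K μ).exists_colimitsOfShape B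
  obtain ⟨I, _, _, Φ, _⟩ := IsCardinalFiltered.exists_cardinal_directed J μ
  let F : I ⥤ K := Φ ⋙ p.diag
  let c : Cocone F := p.cocone.whisker Φ
  have hc : IsColimit c := (Functor.Final.isColimitWhiskerEquiv Φ _).symm p.isColimit
  have hF (i : I) : IsCardinalPresentable (F.obj i) μ := p.prop_diag_obj _
  let Op (j : I) : Type w := Σ x y : ι, (G x ⟶ G y) × (G x ⟶ F.obj j)
  have hOp (j : I) : ∃ e : Θ → Option (Op j), Function.Surjective e := by
    obtain ⟨z, ⟨ez⟩⟩ := hG _ (hF j)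
    let f : Op j → Θ := fun o ↦ some ⟨o.1, o.2.1, z, o.2.2.1, o.2.2.2 ≫ ez.hom⟩
    have hf : Function.Injective f := by
      rintro ⟨x, y, g, u⟩ ⟨x', y', g', u'⟩ h
      obtain ⟨rfl, h⟩ := Sigma.mk.inj (Option.some.inj h)
      obtain ⟨rfl, h⟩ := Sigma.mk.inj (eq_of_heq h)
      obtain ⟨rfl, h⟩ := Prod.mk.inj (eq_of_heq (Sigma.mk.inj (eq_of_heq h)).2)
      obtain rfl : u = u' := (cancel_mono ez.hom).1 h
      rfl
    have : Nonempty (Option (Op j)) := ⟨none⟩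
    refine ⟨Function.invFun (fun o : Option (Op j) ↦ o.elim none f),
      Function.invFun_surjective ?_⟩
    rintro (_ | o) (_ | o') h
    · rfl
    · simp [f] at h
    · simp [f] at h
    · exact congrArg some (hf h)
  choose e he using hOp
  -- A problem solvable over B is solvable at a later stage, since source and target of its morphism
  -- are μ-presentable; an unsolvable one stays at j.
  have hnxt (j : I) (o : Op j) : ∃ (k : I) (f : j ⟶ k),
      (∃ v : G o.2.1 ⟶ B, o.2.2.1 ≫ v = o.2.2.2 ≫ c.ι.app j) →
        ∃ t : G o.2.1 ⟶ F.obj k, o.2.2.1 ≫ t = o.2.2.2 ≫ F.map f := by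
    by_cases h : ∃ v : G o.2.1 ⟶ B, o.2.2.1 ≫ v = o.2.2.2 ≫ c.ι.app j
    · obtain ⟨v, hv⟩ := h
      have := hG' o.1
      have := hG' o.2.1
      obtain ⟨i, v', rfl⟩ := IsCardinalPresentable.exists_hom_of_isColimit μ hc v
      obtain ⟨k, a, b, h⟩ := IsCardinalPresentable.exists_eq_of_isColimit μ hc
        (o.2.2.1 ≫ v') o.2.2.2 (by simpa using hv)
      exact ⟨k, b, fun _ ↦ ⟨v' ≫ F.map a, by simpa using h⟩⟩
    · exact ⟨j, 𝟙 j, fun h' ↦ (h h').elim⟩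
  choose nxt hnxt hnxt' using hnxt
  let op (t : Θ) (j : I) : I := (e j t).elim j (nxt j)
  let P (S : Set I) : Prop := #S ≤ θ ∧ IsCardinalFiltered S μ ∧ ∀ t, ∀ j ∈ S, op t j ∈ S
  have hP (A : Set I) (hA : #A ≤ θ) : ∃ S : Set I, A ⊆ S ∧ P S :=
    IsCardinalFiltered.exists_superset_directed_closed hθ0 hθ hΘ op A hA
  have hPf : IsCardinalFiltered (Subtype P) (Order.succ θ) :=
    isCardinalFiltered_preorder _ _ (fun T S hT ↦ by
      obtain ⟨U, hU, hPU⟩ := hP (⋃ t, (S t).1) (by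
        rw [← Order.lt_succ_iff, ← hasCardinalLT_iff_cardinal_mk_lt]
        refine hasCardinalLT_iUnion _ (by rwa [hasCardinalLT_iff_cardinal_mk_lt]) (fun t ↦ ?_)
        rw [hasCardinalLT_iff_cardinal_mk_lt, Order.lt_succ_iff]
        exact (S t).2.1)
      exact ⟨⟨U, hPU⟩, fun t ↦ (Set.subset_iUnion (fun t ↦ (S t).1) t).trans hU⟩)
  have := isFiltered_of_isCardinalFiltered (Subtype P) (Order.succ θ)
  refine ⟨Subtype P, inferInstance, hPf, colimitRestrict.functor F P,
    (colimitRestrict.cocone F c P).ι, ⟨colimitRestrict.isColimitCocone F hc P (fun i ↦ ?_)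
      (fun S T ↦ ⟨IsFiltered.max S T, leOfHom (IsFiltered.leftToMax S T),
        leOfHom (IsFiltered.rightToMax S T)⟩)⟩, fun ⟨S, hS⟩ ↦ ⟨?_, ?_⟩⟩
  · obtain ⟨S, h1, h2⟩ := hP {i} (by simpa using one_le_aleph0.trans hθ0)
    exact ⟨S, h2, h1 rfl⟩
  · have hSθ : HasCardinalLT S (Order.succ θ) := by
      rw [hasCardinalLT_iff_cardinal_mk_lt, Order.lt_succ_iff]
      exact hS.1
    have hA : HasCardinalLT (Arrow S) (Order.succ θ) :=
      (hasCardinalLT_prod (hθ0.trans (Order.le_succ θ)) hSθ hSθ).of_injective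
        (fun f : Arrow S ↦ (f.left, f.right)) (by
          rintro ⟨a, b, f⟩ ⟨a', b', f'⟩ h
          obtain ⟨rfl, rfl⟩ := Prod.mk.inj h
          obtain rfl := Subsingleton.elim f f'
          rfl)
    have (i : S) : IsCardinalPresentable
        (((Subtype.mono_coe (· ∈ S)).functor ⋙ F).obj i) (Order.succ θ) :=
      isCardinalPresentable_of_le (F.obj i.1) hle
    exact isCardinalPresentable_of_isColimit _
      (colimit.isColimit ((Subtype.mono_coe (· ∈ S)).functor ⋙ F)) _ hA
  · have := hS.2.1
    refine isPure_colimitRestrict_toPt G hG c S (fun j hj x y g u v h ↦ ?_)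
    obtain ⟨t, ht⟩ := he j (some ⟨x, y, g, u⟩)
    refine ⟨nxt j ⟨x, y, g, u⟩, ?_, hnxt j ⟨x, y, g, u⟩, hnxt' j ⟨x, y, g, u⟩ ⟨v, h⟩⟩
    have := hS.2.2 t j hj
    simpa [op, ht] using this

end CategoryTheory.IsCardinalLocallyPresentable

/-! ### Jointly conservative families of presentable objects. -/

namespace CategoryTheory

variable {C : Type u₂} [Category.{w} C]

/-- A family of objects is jointly conservative if the functors which it represents jointly
reflect isomorphisms. -/
def IsJointlyConservative {ι : Type w} (X : ι → C) : Prop :=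
  ∀ ⦃A B : C⦄ (f : A ⟶ B),
    (∀ i, Function.Bijective (fun g : X i ⟶ A ↦ g ≫ f)) → IsIso f

variable {κ : Cardinal.{w}} [Fact κ.IsRegular]

lemma IsCardinalLocallyPresentable.exists_isJointlyConservative
    [IsCardinalLocallyPresentable C κ] :
    ∃ (ι : Type w) (X : ι → C), (∀ i, IsCardinalPresentable (X i) κ) ∧
      IsJointlyConservative X := by
  obtain ⟨ι, X, hX, hX'⟩ := exists_small_family C κ
  have hgen := (isCardinalFilteredGenerator_isCardinalPresentable C κ).isStrongGenerator
  refine ⟨ι, X, hX, fun A B f hf ↦ ?_⟩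
  have hf' (G : C) (hG : isCardinalPresentable C κ G) :
      Function.Bijective (fun g : G ⟶ A ↦ g ≫ f) := by
    obtain ⟨x, ⟨e⟩⟩ := hX' G hG
    refine ⟨fun g g' h ↦ ?_, fun g ↦ ?_⟩
    · rw [← cancel_epi e.inv]
      exact (hf x).1 (by simpa using e.inv ≫= h)
    · obtain ⟨g', hg'⟩ := (hf x).2 (e.inv ≫ g)
      exact ⟨e.hom ≫ g', by simpa using e.hom ≫= hg'⟩
  have : Mono f := by
    rw [hgen.isSeparating.mono_iff]
    exact fun G hG g h hgh ↦ (hf' G hG).1 hgh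
  exact hgen.isIso_of_mono f fun G hG ↦ (hf' G hG).2

/-- The represented functors preserve the κ-filtered colimit, so they invert the comparison from it
to `c.pt`. -/
lemma IsJointlyConservative.nonempty_isColimit [HasColimitsOfSize.{w, w} C]
    {ι : Type w} {X : ι → C} (hX : IsJointlyConservative X)
    (hX' : ∀ i, IsCardinalPresentable (X i) κ)
    {J : Type w} [SmallCategory J] [IsCardinalFiltered J κ] {F : J ⥤ C} (c : Cocone F)
    (h : ∀ i, Nonempty (IsColimit ((coyoneda.obj (op (X i))).mapCocone c))) :
    Nonempty (IsColimit c) := by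
  have : IsIso ((colimit.isColimit F).desc c) := hX _ fun i ↦ by
    have := preservesColimitsOfShape_of_isCardinalPresentable (X i) κ J
    let e := (isColimitOfPreserves (coyoneda.obj (op (X i)))
      (colimit.isColimit F)).coconePointUniqueUpToIso (h i).some
    have he : e.hom = (coyoneda.obj (op (X i))).map ((colimit.isColimit F).desc c) :=
      (isColimitOfPreserves (coyoneda.obj (op (X i))) (colimit.isColimit F)).hom_ext fun j ↦ by
        rw [IsColimit.comp_coconePointUniqueUpToIso_hom, Functor.mapCocone_ι_app,
          Functor.mapCocone_ι_app, ← Functor.map_comp, IsColimit.fac]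
    have h' : Function.Bijective e.hom := (isIso_iff_bijective e.hom).1 inferInstance
    rw [he] at h'
    exact h'
  exact ⟨IsColimit.ofPointIso (colimit.isColimit F)⟩

/-- A jointly conservative small family of `κ`-presentable objects in a cocomplete category
generates a dense subcategory under `κ`-small colimits. -/
lemma IsJointlyConservative.isDense_colimitsCardinalClosure_ι [HasColimitsOfSize.{w, w} C]
    {ι : Type w} {X : ι → C} (hX : IsJointlyConservative X)
    (hX' : ∀ i, IsCardinalPresentable (X i) κ) :
    ((ObjectProperty.ofObj X).colimitsCardinalClosure κ).ι.IsDense where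
  isDenseAt Y := by
    let P := ObjectProperty.ofObj X
    let E := Functor.LeftExtension.mk _ (P.colimitsCardinalClosure κ).ι.rightUnitor.inv
    have : HasColimitsOfShape (CostructuredArrow (P.colimitsCardinalClosure κ).ι Y) C :=
      hasColimitsOfShape_of_equivalence
        (equivSmallModel.{w} (CostructuredArrow (P.colimitsCardinalClosure κ).ι Y)).symm
    let Φ := CostructuredArrow.proj (P.colimitsCardinalClosure κ).ι Y ⋙
      (P.colimitsCardinalClosure κ).ι
    let c : Cocone Φ := { pt := Y, ι := {
      app j := j.hom
      naturality _ _ f := (CostructuredArrow.w f).trans (Category.comp_id _).symm } }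
    have hc (j) : (E.coconeAt Y).ι.app j = c.ι.app j := Category.id_comp _
    have hiso : IsIso (colimit.desc Φ c) := hX _ fun i ↦ by
      have hi : P (X i) := ⟨i⟩
      have := hX' i
      refine ⟨fun g₁ g₂ (h : g₁ ≫ colimit.desc Φ c = g₂ ≫ colimit.desc Φ c) ↦ ?_, fun g ↦ ?_⟩
      · obtain ⟨j, φ₁, φ₂, rfl, rfl⟩ :
            ∃ (j : CostructuredArrow (P.colimitsCardinalClosure κ).ι Y)
              (φ₁ φ₂ : X i ⟶ Φ.obj j), φ₁ ≫ colimit.ι _ _ = g₁ ∧ φ₂ ≫ colimit.ι _ _ = g₂ := by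
          obtain ⟨j₁, f₁, hf₁⟩ :=
            IsCardinalPresentable.exists_hom_of_isColimit κ (colimit.isColimit _) g₁
          obtain ⟨j₂, f₂, hf₂⟩ :=
            IsCardinalPresentable.exists_hom_of_isColimit κ (colimit.isColimit _) g₂
          exact ⟨IsFiltered.max j₁ j₂, f₁ ≫ Φ.map (IsFiltered.leftToMax j₁ j₂),
            f₂ ≫ Φ.map (IsFiltered.rightToMax j₁ j₂), by simpa, by simpa⟩
        have : (P.colimitsCardinalClosure κ).IsClosedUnderColimitsOfShape
            WalkingParallelPair := by
          apply ObjectProperty.isClosedUnderColimitsOfShape_colimitsCardinalClosure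
          refine .of_le ?_ (Cardinal.IsRegular.aleph0_le Fact.out)
          simp only [hasCardinalLT_aleph0_iff]
          infer_instance
        -- The coequalizer stays in the closure and maps to Y, so the two morphisms are already
        -- identified at this later index.
        let obj : (P.colimitsCardinalClosure κ).FullSubcategory :=
          ⟨coequalizer φ₁ φ₂, by
            apply ObjectProperty.prop_colimit
            rintro (_ | _)
            · exact P.le_colimitsCardinalClosure _ _ hi
            · exact j.left.2⟩
        let a : (P.colimitsCardinalClosure κ).ι.obj obj ⟶ Y :=
          coequalizer.desc (c.ι.app j) (by
            rwa [Category.assoc, Category.assoc, colimit.ι_desc] at h)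
        let ψ : j ⟶ CostructuredArrow.mk a :=
          CostructuredArrow.homMk (ObjectProperty.homMk (coequalizer.π _ _))
            (coequalizer.π_desc _ _)
        rw [← colimit.w Φ ψ]
        apply coequalizer.condition_assoc
      · let γ : CostructuredArrow (P.colimitsCardinalClosure κ).ι Y :=
          CostructuredArrow.mk (Y := ⟨X i, P.le_colimitsCardinalClosure _ _ hi⟩) (by exact g)
        exact ⟨colimit.ι Φ γ, colimit.ι_desc c γ⟩
    exact ⟨IsColimit.ofIsoColimit (colimit.isColimit _) (Cocone.ext
      (@asIso _ _ _ _ _ hiso) (fun j ↦ (colimit.ι_desc c j).trans (hc j).symm))⟩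

lemma IsJointlyConservative.isCardinalLocallyPresentable [HasColimitsOfSize.{w, w} C]
    {ι : Type w} {X : ι → C} (hX : IsJointlyConservative X)
    (hX' : ∀ i, IsCardinalPresentable (X i) κ) :
    IsCardinalLocallyPresentable C κ := by
  have := hX.isDense_colimitsCardinalClosure_ι hX'
  have : HasCardinalFilteredGenerator C κ :=
    { exists_generator := ⟨((ObjectProperty.ofObj X).colimitsCardinalClosure κ), inferInstance,
        IsCardinalFilteredGenerator.of_isDense_ι _ _
          (ObjectProperty.colimitsCardinalClosure_le_isCardinalPresentable _
            (by rintro _ ⟨i⟩; exact hX' i))⟩ }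
  constructor

/-- By density the identity of Y factors through an object of the closure, so Y is a retract of it,
and the closure contains its retracts. -/
lemma IsJointlyConservative.isCardinalPresentable_le [HasColimitsOfSize.{w, w} C]
    {ι : Type w} {X : ι → C} (hX : IsJointlyConservative X)
    (hX' : ∀ i, IsCardinalPresentable (X i) κ) :
    isCardinalPresentable C κ ≤ (ObjectProperty.ofObj X).colimitsCardinalClosure κ := by
  have := hX.isDense_colimitsCardinalClosure_ι hX'
  intro Y hY
  rw [isCardinalPresentable_iff] at hY
  rw [← ((ObjectProperty.ofObj X).colimitsCardinalClosure κ).retractClosure_eq_self]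
  obtain ⟨j, φ, hφ⟩ := IsCardinalPresentable.exists_hom_of_isColimit κ
    (((ObjectProperty.ofObj X).colimitsCardinalClosure κ).ι.denseAt Y) (𝟙 Y)
  exact ⟨_, j.left.2, ⟨{ i := _, r := _, retract := hφ }⟩⟩

end CategoryTheory

/-! ### Enriched versus ordinary colimits and presentability. -/

namespace VCategory

variable (V : Type u₁) [Category.{w} V] [MonoidalCategory V]
variable {C : Type u₂} [Category.{w} C] [EnrichedOrdinaryCategory V C]

lemma eHomEquiv_comp_eq_whiskerLeft {X Y Z : C} (f : X ⟶ Y) (g : Y ⟶ Z) :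
    eHomEquiv V (f ≫ g) = eHomEquiv V f ≫ eHomWhiskerLeft V X g := by
  rw [eHomEquiv_comp, eHomWhiskerLeft, rightUnitor_inv_naturality_assoc, MonoidalCategory.tensorHom_def,
    unitors_inv_equal, Category.assoc]

lemma eHomEquiv_comp_eq_whiskerRight {X Y Z : C} (f : X ⟶ Y) (g : Y ⟶ Z) :
    eHomEquiv V (f ≫ g) = eHomEquiv V g ≫ eHomWhiskerRight V f Z := by
  rw [eHomEquiv_comp, eHomWhiskerRight, leftUnitor_inv_naturality_assoc, MonoidalCategory.tensorHom_def',
    Category.assoc]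

/-- The represented functor of the underlying category is recovered from the enriched one. -/
def coyonedaIso (X : C) :
    coyoneda.obj (op X) ≅ eCoyoneda V X ⋙ coyoneda.obj (op (𝟙_ V)) :=
  NatIso.ofComponents (fun _ ↦ (eHomEquiv V).toIso) (fun g ↦ by
    ext f
    exact eHomEquiv_comp_eq_whiskerLeft V f g)

/-- The contravariant represented functor of the underlying category is recovered from the
enriched one. -/
def yonedaIso (Y : C) :
    yoneda.obj Y ≅ (eHomFunctor V C).flip.obj Y ⋙ coyoneda.obj (op (𝟙_ V)) :=
  NatIso.ofComponents (fun _ ↦ (eHomEquiv V).toIso) (fun g ↦ by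
    ext f
    exact eHomEquiv_comp_eq_whiskerRight V g.unop f)

variable {V}

/-- Apply the limit-preserving functor represented by the unit to the limit cones of hom-objects. -/
lemma IsConicalColimit.nonempty_isColimit {J : Type w} [SmallCategory J] {F : J ⥤ C}
    {c : Cocone F} (hc : IsConicalColimit V c) : Nonempty (IsColimit c) :=
  ⟨c.isColimitYonedaEquiv.symm fun A ↦
    IsLimit.mapConeEquiv (yonedaIso V A).symm
      (isLimitOfPreserves (coyoneda.obj (op (𝟙_ V))) (hc A).some)⟩

lemma IsConicalColimit.of_iso {J : Type w} [SmallCategory J] {F : J ⥤ C}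
    {c c' : Cocone F} (hc : IsConicalColimit V c) (e : c ≅ c') : IsConicalColimit V c' :=
  fun A ↦ ⟨(hc A).some.ofIsoLimit (Cone.ext
    (((eHomFunctor V C).flip.obj A).mapIso ((Cocone.forget F).mapIso e.symm).op) (fun j ↦ by
      change eHomWhiskerRight V (c.ι.app j.unop) A =
        eHomWhiskerRight V e.inv.hom A ≫ eHomWhiskerRight V (c'.ι.app j.unop) A
      rw [← eHomWhiskerRight_comp, e.inv.w]))⟩

lemma whiskerLeft_comp_eHomWhiskerLeft {X Y : V} {A T B B' : C} (η : X ⟶ (A ⟶[V] T))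
    (f : B ⟶ B') (g : Y ⟶ (T ⟶[V] B)) :
    X ◁ (g ≫ eHomWhiskerLeft V T f) ≫ η ▷ (T ⟶[V] B') ≫ eComp V A T B' =
      (X ◁ g ≫ η ▷ (T ⟶[V] B) ≫ eComp V A T B) ≫ eHomWhiskerLeft V A f := by
  rw [Category.assoc, Category.assoc, eComp_eHomWhiskerLeft, MonoidalCategory.whiskerLeft_comp,
    Category.assoc, whisker_exchange_assoc]

section Cocomplete

variable [MonoidalClosed V]

/-- A conical colimit of `F` exists and is also an ordinary one, hence isomorphic to `c`. -/
lemma IsCocomplete.isConicalColimit (h : IsCocomplete V C) {J : Type w} [SmallCategory J]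
    {F : J ⥤ C} {c : Cocone F} (hc : IsColimit c) : IsConicalColimit V c := by
  obtain ⟨c', hc'⟩ := h.conicalColimits J F
  exact hc'.of_iso (hc'.nonempty_isColimit.some.uniqueUpToIso hc)

lemma IsCocomplete.hasColimitsOfSize (h : IsCocomplete V C) : HasColimitsOfSize.{w, w} C where
  has_colimits_of_shape J _ := ⟨fun F ↦ by
    obtain ⟨c, hc⟩ := h.conicalColimits J F
    exact ⟨⟨c, hc.nonempty_isColimit.some⟩⟩⟩

lemma IsCopower.bijective {X : V} {A T : C} {η : X ⟶ (A ⟶[V] T)} (h : IsCopower V η)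
    (Y : V) (B : C) :
    Function.Bijective (fun g : Y ⟶ (T ⟶[V] B) ↦ X ◁ g ≫ η ▷ (T ⟶[V] B) ≫ eComp V A T B) := by
  have := h B
  have h1 : Function.Bijective (fun g : Y ⟶ (T ⟶[V] B) ↦
      g ≫ MonoidalClosed.curry (η ▷ (T ⟶[V] B) ≫ eComp V A T B)) :=
    ⟨fun _ _ h ↦ (cancel_mono _).1 h,
      fun g ↦ ⟨g ≫ inv (MonoidalClosed.curry (η ▷ (T ⟶[V] B) ≫ eComp V A T B)), by simp⟩⟩
  have h2 : Function.Bijective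
      (MonoidalClosed.uncurry : (Y ⟶ (ihom X).obj (A ⟶[V] B)) → (X ⊗ Y ⟶ (A ⟶[V] B))) :=
    ((ihom.adjunction X).homEquiv _ _).symm.bijective
  convert h2.comp h1 using 2 with g
  simp [MonoidalClosed.uncurry_natural_left]

/-- The universal property of the copower, as an isomorphism of functors. -/
noncomputable def IsCopower.iso {X : V} {A T : C} {η : X ⟶ (A ⟶[V] T)} (h : IsCopower V η)
    (Y : V) :
    eCoyoneda V T ⋙ coyoneda.obj (op Y) ≅ eCoyoneda V A ⋙ coyoneda.obj (op (X ⊗ Y)) :=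
  NatIso.ofComponents (fun B ↦ (Equiv.ofBijective _ (h.bijective Y B)).toIso) (fun f ↦ by
    ext g
    exact whiskerLeft_comp_eHomWhiskerLeft η f g)

end Cocomplete

section Presentable

variable {κ : Cardinal.{w}} [Fact κ.IsRegular]

lemma IsPresentableObject.of_le {κ' : Cardinal.{w}} [Fact κ'.IsRegular] (h : κ ≤ κ') {G : C}
    (hG : IsPresentableObject V κ G) : IsPresentableObject V κ' G := fun J _ _ F c hc ↦
  have := IsCardinalFiltered.of_le J h
  hG J F c hc

/-- Colimit cocones in V over κ-filtered diagrams are detected by the `X i`, which reduces enriched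
presentability to set-valued functors. -/
lemma isPresentableObject_of_isCardinalAccessible [HasColimitsOfSize.{w, w} V]
    {ι : Type w} {X : ι → V} (hX : IsJointlyConservative X)
    (hX' : ∀ i, IsCardinalPresentable (X i) κ) {G : C}
    (hG : ∀ i, (eCoyoneda V G ⋙ coyoneda.obj (op (X i))).IsCardinalAccessible κ) :
    IsPresentableObject V κ G := fun J _ _ F c hc ↦ by
  refine hX.nonempty_isColimit hX' _ fun i ↦ ?_
  have := (eCoyoneda V G ⋙
    coyoneda.obj (op (X i))).preservesColimitsOfShape_of_isCardinalAccessible κ J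
  exact ⟨isColimitOfPreserves (eCoyoneda V G ⋙ coyoneda.obj (op (X i)))
    hc.nonempty_isColimit.some⟩

/-- The objects which are `κ`-presentable in the enriched sense, tested on a family of objects
of `V`. -/
def isCardinalAccessibleCoyoneda {ι : Type w} (X : ι → V) (κ : Cardinal.{w}) [Fact κ.IsRegular] :
    ObjectProperty C :=
  fun G ↦ ∀ i, (eCoyoneda V G ⋙ coyoneda.obj (op (X i))).IsCardinalAccessible κ

instance {ι : Type w} (X : ι → V) :
    (isCardinalAccessibleCoyoneda (C := C) X κ).IsClosedUnderIsomorphisms where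
  of_iso e h i :=
    have := h i
    Functor.isCardinalAccessible_of_natIso
      (Functor.isoWhiskerRight ((eHomFunctor V C).mapIso e.symm.op) _) κ

variable [MonoidalClosed V]

lemma IsPresentableObject.isCardinalAccessible (h : IsCocomplete V C) {G : C}
    (hG : IsPresentableObject V κ G) (Y : V) [IsCardinalPresentable Y κ] :
    (eCoyoneda V G ⋙ coyoneda.obj (op Y)).IsCardinalAccessible κ := by
  have : (eCoyoneda V G).IsCardinalAccessible κ :=
    { preservesColimitOfShape J _ _ :=
        ⟨fun {F} ↦ ⟨fun {c} hc ↦ hG J F c (h.isConicalColimit hc)⟩⟩ }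
  infer_instance

lemma IsPresentableObject.isCardinalPresentable (h : IsCocomplete V C) {G : C}
    (hG : IsPresentableObject V κ G) [IsCardinalPresentable (𝟙_ V) κ] :
    IsCardinalPresentable G κ :=
  have := hG.isCardinalAccessible h (𝟙_ V)
  Functor.isCardinalAccessible_of_natIso (coyonedaIso V G).symm κ

/-- Morphisms from `X i` to the hom-object out of T are morphisms from `Y ⊗ X i` to the hom-object
out of G; this is why the tensor products must be presentable. -/
lemma IsPresentableObject.copower (h : IsCocomplete V C) [HasColimitsOfSize.{w, w} V]
    {ι : Type w} {X : ι → V} (hX : IsJointlyConservative X)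
    (hX' : ∀ i, IsCardinalPresentable (X i) κ) {G T : C}
    (hG : IsPresentableObject V κ G) {Y : V} {η : Y ⟶ (G ⟶[V] T)} (hη : IsCopower V η)
    (hY : ∀ i, IsCardinalPresentable (Y ⊗ X i) κ) :
    IsPresentableObject V κ T :=
  isPresentableObject_of_isCardinalAccessible hX hX' fun i ↦
    have := hG.isCardinalAccessible h (Y ⊗ X i)
    Functor.isCardinalAccessible_of_natIso (hη.iso (X i)).symm κ

/-- Homming out of a κ-small colimit is a κ-small limit, and κ-small limits of κ-accessible
set-valued functors are κ-accessible. -/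
lemma isClosedUnderColimitsOfShape_isCardinalAccessibleCoyoneda (h : IsCocomplete V C)
    {ι : Type w} (X : ι → V) (J : Type w) [SmallCategory J] (hJ : HasCardinalLT (Arrow J) κ) :
    (isCardinalAccessibleCoyoneda (C := C) X κ).IsClosedUnderColimitsOfShape J where
  colimitsOfShape_le := by
    rintro Y ⟨p⟩ i
    let T : Cᵒᵖ ⥤ C ⥤ Type w := eHomFunctor V C ⋙
      (Functor.whiskeringRight C V (Type w)).obj (coyoneda.obj (op (X i)))
    have hp (k : Jᵒᵖ) : ((p.diag.op ⋙ T).obj k).IsCardinalAccessible κ :=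
      p.prop_diag_obj k.unop i
    exact Functor.isCardinalAccessible_of_isLimit (T.mapCone p.cocone.op)
      (evaluationJointlyReflectsLimits _ fun B ↦
        isLimitOfPreserves (coyoneda.obj (op (X i))) (h.isConicalColimit p.isColimit B).some) κ
      (by simpa)

end Presentable

end VCategory

/-! ### Raising the presentability rank. -/

namespace VCategory

variable {V : Type u₁} [Category.{w} V] [MonoidalCategory V]
variable {K : Type u₂} [Category.{w} K] [EnrichedOrdinaryCategory V K]

section LocallyPresentable

variable [MonoidalClosed V]

lemma IsCopower.bijective_comp_iff {X : V} {A T : K} {η : X ⟶ (A ⟶[V] T)}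
    (h : IsCopower V η) {B B' : K} (f : B ⟶ B') :
    Function.Bijective (fun g : T ⟶ B ↦ g ≫ f) ↔
      Function.Bijective (fun g : X ⟶ (A ⟶[V] B) ↦ g ≫ eHomWhiskerLeft V A f) := by
  let e : coyoneda.obj (op T) ≅ eCoyoneda V A ⋙ coyoneda.obj (op X) :=
    coyonedaIso V T ≪≫ h.iso (𝟙_ V) ≪≫
      Functor.isoWhiskerLeft (eCoyoneda V A) (coyoneda.mapIso (ρ_ X).symm.op)
  exact ((isIso_iff_bijective _).symm.trans (NatIso.isIso_map_iff e f)).trans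
    (isIso_iff_bijective _)

/-- In a locally `κ`-presentable `V`-category, for all sufficiently large regular cardinals `ν`,
the underlying category is locally `ν`-presentable, and its `ν`-presentable objects are
`ν`-presentable in the enriched sense. -/
theorem IsLocallyCardinalPresentable.exists_le [HasColimitsOfSize.{w, w} V]
    [IsLocallyPresentable.{w} V] {κ : Cardinal.{w}} [Fact κ.IsRegular]
    (hK : IsLocallyCardinalPresentable V K κ) :
    ∃ (μ : Cardinal.{w}) (_ : Fact μ.IsRegular), κ ≤ μ ∧
      ∀ (ν : Cardinal.{w}) [Fact ν.IsRegular], μ ≤ ν → IsCardinalLocallyPresentable K ν ∧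
        ∀ G : K, IsCardinalPresentable G ν → IsPresentableObject V ν G := by
  have hc := hK.cocomplete
  have := hc.hasColimitsOfSize
  obtain ⟨α, _, _⟩ := IsLocallyPresentable.exists_cardinal.{w} V
  obtain ⟨ι, X, hX', hX⟩ := IsCardinalLocallyPresentable.exists_isJointlyConservative
    (C := V) (κ := α)
  obtain ⟨ι', G, hG, hG'⟩ := hK.exists_strongGenerator
  have hI : IsPresentable.{w} (𝟙_ V) := inferInstance
  obtain ⟨γ, _, hγ⟩ := hI.exists_cardinal
  have hXX (p : ι × ι) : IsPresentable.{w} (X p.1 ⊗ X p.2) := inferInstance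
  choose β hβ hβ' using fun p ↦ (hXX p).exists_cardinal
  -- Bounds the ranks of `K`, V, the unit and all products `X i ⊗ X j`; its successor is regular.
  let s : Cardinal.{w} := κ + α + γ + Cardinal.sum β
  have hκs : κ ≤ s := (self_le_add_right _ _).trans
    ((self_le_add_right _ _).trans (self_le_add_right _ _))
  have hαs : α ≤ s := (self_le_add_left _ _).trans
    ((self_le_add_right _ _).trans (self_le_add_right _ _))
  have hγs : γ ≤ s := (self_le_add_left _ _).trans (self_le_add_right _ _)
  have hβs (p) : β p ≤ s := (Cardinal.le_sum β p).trans (self_le_add_left _ _)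
  have hs : s ≤ Order.succ s := Order.le_succ s
  refine ⟨Order.succ s, ⟨Cardinal.isRegular_succ
    ((Cardinal.IsRegular.aleph0_le Fact.out).trans hκs)⟩, hκs.trans hs, fun ν _ hν ↦ ?_⟩
  have hsν : s ≤ ν := hs.trans hν
  have : IsCardinalPresentable (𝟙_ V) ν := isCardinalPresentable_of_le _ (hγs.trans hsν)
  have hXν (i : ι) : IsCardinalPresentable (X i) ν :=
    isCardinalPresentable_of_le _ (hαs.trans hsν)
  have hXXν (i j : ι) : IsCardinalPresentable (X i ⊗ X j) ν :=
    have := hβ' (i, j)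
    isCardinalPresentable_of_le _ ((hβs (i, j)).trans hsν)
  choose T η hη using fun (p : ι × ι') ↦ hc.copowers (X p.1) (G p.2)
  have hT (p : ι × ι') : IsPresentableObject V ν (T p) :=
    ((hG p.2).of_le (hκs.trans hsν)).copower hc hX hXν (hη p) (hXXν p.1)
  have hT' (p : ι × ι') : IsCardinalPresentable (T p) ν := (hT p).isCardinalPresentable hc
  have hTc : IsJointlyConservative T := fun A B f hf ↦ hG' f fun k ↦ hX _ fun i ↦
    ((hη (i, k)).bijective_comp_iff f).1 (hf (i, k))
  refine ⟨hTc.isCardinalLocallyPresentable hT', fun H hH ↦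
    isPresentableObject_of_isCardinalAccessible hX hXν ?_⟩
  refine ObjectProperty.colimitsCardinalClosure_le
    (Q := isCardinalAccessibleCoyoneda (C := K) X ν) _ _
    (fun J _ hJ ↦ isClosedUnderColimitsOfShape_isCardinalAccessibleCoyoneda hc X J hJ) ?_ H
    (hTc.isCardinalPresentable_le hT' H hH)
  rintro _ ⟨p⟩ i
  exact (hT p).isCardinalAccessible hc (X i)

end LocallyPresentable

/-! ### Full subcategories closed under filtered colimits. -/

section FullSubcategory

variable {P : ObjectProperty K} {J : Type w} [SmallCategory J]

lemma IsConicalColimit.of_mapCocone_ι {F : J ⥤ P.FullSubcategory} {c : Cocone F}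
    (hc : IsConicalColimit V (P.ι.mapCocone c)) : IsConicalColimit V c :=
  fun A ↦ hc A.obj

/-- A cocone in a category whose point belongs to a full subcategory. -/
def liftCocone {F : J ⥤ P.FullSubcategory} (c : Cocone (F ⋙ P.ι)) (hc : P c.pt) : Cocone F where
  pt := ⟨c.pt, hc⟩
  ι := { app j := ObjectProperty.homMk (c.ι.app j)
         naturality _ _ f := P.ι.map_injective (c.ι.naturality f) }

lemma isConicalColimit_liftCocone {F : J ⥤ P.FullSubcategory} {c : Cocone (F ⋙ P.ι)}
    (hc : IsConicalColimit V c) (h : P c.pt) : IsConicalColimit V (liftCocone c h) :=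
  .of_mapCocone_ι hc

variable {κ : Cardinal.{w}} [Fact κ.IsRegular] [IsCardinalFiltered J κ] [MonoidalClosed V]

/-- The colimit formed in `K` lies in `P`, so it is also the colimit in the subcategory and agrees
with `c`. -/
lemma IsCocomplete.isConicalColimit_mapCocone_ι (h : IsCocomplete V K)
    (hP : IsClosedUnderFilteredColimits V κ P) {F : J ⥤ P.FullSubcategory} {c : Cocone F}
    (hc : IsConicalColimit V c) : IsConicalColimit V (P.ι.mapCocone c) := by
  obtain ⟨d, hd⟩ := h.conicalColimits J (F ⋙ P.ι)
  have hd' : P d.pt := hP J _ d hd fun j ↦ (F.obj j).property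
  exact IsConicalColimit.of_iso hd ((Cocone.functoriality F P.ι).mapIso
    ((isConicalColimit_liftCocone hd hd').nonempty_isColimit.some.uniqueUpToIso
      hc.nonempty_isColimit.some))

lemma IsPresentableObject.fullSubcategory (h : IsCocomplete V K)
    (hP : IsClosedUnderFilteredColimits V κ P) {G : P.FullSubcategory}
    (hG : IsPresentableObject V κ G.obj) : IsPresentableObject V κ G :=
  fun J _ _ _ c hc ↦ hG J _ (P.ι.mapCocone c) (h.isConicalColimit_mapCocone_ι hP hc)

end FullSubcategory

lemma IsClosedUnderFilteredColimits.of_le {P : ObjectProperty K} {κ ν : Cardinal.{w}}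
    [Fact κ.IsRegular] [Fact ν.IsRegular] (h : κ ≤ ν)
    (hP : IsClosedUnderFilteredColimits V κ P) : IsClosedUnderFilteredColimits V ν P :=
  fun J _ _ F c hc hF ↦
    have := IsCardinalFiltered.of_le J h
    hP J F c hc hF

end VCategory

lemma OrdinaryPurity.IsPure.of_isIso {K : Type u₂} [Category.{w} K] {κ : Cardinal.{w}}
    [Fact κ.IsRegular] {A B : K} (f : A ⟶ B) [IsIso f] : IsPure κ f :=
  fun _ _ _ _ g u v h ↦ ⟨v ≫ inv f, by rw [← Category.assoc, h]; simp⟩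

/-! ### The main theorem. -/

theorem mainTheorem6
    (V : Type u₁) [Category.{w} V] [MonoidalCategory V] [SymmetricCategory V] [MonoidalClosed V]
    [HasLimitsOfSize.{w, w} V] [HasColimitsOfSize.{w, w} V] [IsLocallyPresentable.{w} V]
    (K : Type u₂) [Category.{w} K] [EnrichedOrdinaryCategory V K]
    (κ : Cardinal.{w}) [Fact κ.IsRegular]
    (hK : VCategory.IsLocallyCardinalPresentable V K κ)
    (A : ObjectProperty K)
    (hcolim : VCategory.IsClosedUnderFilteredColimits V κ A)
    (hpure : OrdinaryPurity.IsClosedUnderPureSubobjects κ A) :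
    VCategory.IsAccessible V A.FullSubcategory := by
  have hc := hK.cocomplete
  obtain ⟨μ, _, hκμ, hμ⟩ := hK.exists_le
  obtain ⟨_, -⟩ := hμ μ le_rfl
  obtain ⟨ν, _, hμν, hν⟩ := IsCardinalLocallyPresentable.exists_pure_presentation K μ
  obtain ⟨_, hpres⟩ := hμ ν hμν
  have hcolim' := hcolim.of_le (hκμ.trans hμν)
  obtain ⟨ι, G, hG, hG'⟩ := IsCardinalLocallyPresentable.exists_small_family K ν
  refine ⟨ν, inferInstance, fun J _ _ F ↦ ?_, {i : ι // A (G i)}, fun i ↦ ⟨G i.1, i.2⟩,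
    fun i ↦ (hpres _ (hG i.1)).fullSubcategory hc hcolim', fun X ↦ ?_⟩
  · obtain ⟨c, hc⟩ := hc.conicalColimits J (F ⋙ A.ι)
    exact ⟨_, VCategory.isConicalColimit_liftCocone hc
      (hcolim' J _ c hc fun j ↦ (F.obj j).property)⟩
  · obtain ⟨J, _, _, F, s, ⟨hs⟩, hF⟩ := hν X.obj
    -- Being a monomorphism comes from μ-purity, as the underlying category is locally
    -- μ-presentable; membership needs only κ-purity.
    have hA (j : J) : A (F.obj j) := hpure (s.app j) (hF j).2.mono ((hF j).2.of_le hκμ) X.property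
    let d := VCategory.liftCocone (P := A) (F := A.lift F hA) (Cocone.mk X.obj s) X.property
    refine ⟨J, inferInstance, inferInstance, A.lift F hA, d.ι, fun j ↦ ?_,
      VCategory.IsConicalColimit.of_mapCocone_ι (hc.isConicalColimit (c := Cocone.mk X.obj s) hs)⟩
    obtain ⟨i, ⟨e⟩⟩ := hG' _ (hF j).1
    -- Isomorphisms are pure monomorphisms, so `A` is closed under isomorphisms.
    exact ⟨⟨i, hpure e.inv inferInstance (.of_isIso _) (hA j)⟩, ⟨A.isoMk e⟩⟩
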